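/- Let $\mathcal H$ be a real Hilbert space, $(\Omega,\mathcal A,\mathbb P)$ a probability space, $(\mathcal F_n)_{n\ge 0}$ an increasing family of sub-$\sigma$-fields of $\mathcal A$, $\theta_0\in\mathcal H$ deterministic, $f:\mathcal H\to\mathbb R$, and $(f_n)_{n\ge 1}$ a sequence of random differentiable functions $f_n:\mathcal H\to\mathbb R$. Let $R>0$, let $N\ge 1$ be an integer, and let $\gamma=\frac{1}{2R^2\sqrt N}$. Write $g'$ for the gradient of a function $g$, and assume: (A1) $f$ is convex and three times differentiable. (A2) For all $\theta_1,\theta_2\in\mathcal H$, the function $\varphi(t)=f(\theta_1+t(\theta_2-\theta_1))$ satisfies $|\varphi'''(t)|\le R\|\theta_1-\theta_2\|\,\varphi''(t)$ for all $t\in\mathbb R$. (A3) $f$ has a global minimum attained at $\theta_*\in\mathcal H$. (A4) $\|f'(\theta)\|\le R$ for all $\theta\in\mathcal H$ and, for every $n\ge1$, almost surely $\|f_n'(\theta)\|\le R$ for all $\theta\in\mathcal H$. (A5) For every $n\ge 1$, $f_n$ is $\mathcal F_n$-measurable, that is, $f_n(\theta)$ is $\mathcal F_n$-measurable for each $\theta\in\mathcal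 H$. (A6) For every $n\ge1$, $f_n'(\theta_{n-1})$ is integrable and $\mathbb E\big(f_n'(\theta_{n-1})\,\big|\,\mathcal F_{n-1}\big)=f'(\theta_{n-1})$ almost surely. (A7) For every $n\ge 1$, $\theta_n=\theta_{n-1}-\gamma f_n'(\theta_{n-1})$. Let $\mu$ be the lowest eigenvalue of the Hessian $f''(\theta_*)$ (in infinite dimension: the least element of its spectrum), and assume that $\mu>0$; the minimizer $\theta_*$ is then unique. Let $\bar\theta_N=\frac1N\sum_{k=0}^{N-1}\theta_k$. Then $f(\bar\theta_N)$ and $\|\bar\theta_N-\theta_*\|^2$ are integrable, and $$\mathbb E f(\bar\theta_N)-f(\theta_*)\ \le\ \frac{R^2}{N\mu}\big(5R\|\theta_0-\theta_*\|+15\big)^4,$$ $$\mathbb E\|\bar\theta_N-\theta_*\|^2\ \le\ \frac{R^2}{N\mu^2}\big(6R\|\theta_0-\theta_*\|+21\big)^4.$$ The step size $\gamma$ does not depend on $\mu$. -/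

import Mathlib

open MeasureTheory ProbabilityTheory

noncomputable section

/-- `f` is three times (Fréchet) differentiable on the whole space; the third derivative is not
required to be continuous. -/
def ThreeTimesDifferentiable {H : Type*} [NormedAddCommGroup H] [NormedSpace ℝ H]
    (f : H → ℝ) : Prop :=
  Differentiable ℝ f ∧ Differentiable ℝ (fderiv ℝ f) ∧ Differentiable ℝ (fderiv ℝ (fderiv ℝ f))

/-- Generalized self-concordance with constant `R`: on each line
`t ↦ θ₁ + t (θ₂ - θ₁)`, the restriction `φ` of `f` satisfies `|φ'''| ≤ R ‖θ₁ - θ₂‖ φ''`. -/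
def GeneralizedSelfConcordant {H : Type*} [NormedAddCommGroup H] [NormedSpace ℝ H]
    (R : ℝ) (f : H → ℝ) : Prop :=
  ∀ (θ₁ θ₂ : H) (t : ℝ),
    |iteratedDeriv 3 (fun s : ℝ => f (θ₁ + s • (θ₂ - θ₁))) t|
      ≤ R * ‖θ₁ - θ₂‖ * iteratedDeriv 2 (fun s : ℝ => f (θ₁ + s • (θ₂ - θ₁))) t

/-- The Hessian of `f` at `θ`, as a bounded operator: the derivative of the gradient. -/
def hessian {H : Type*} [NormedAddCommGroup H] [InnerProductSpace ℝ H] [CompleteSpace H]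
    (f : H → ℝ) (θ : H) : H →L[ℝ] H :=
  fderiv ℝ (gradient f) θ

/-- `μ` is the lowest eigenvalue of the operator `A`: the least element of its spectrum. In finite
dimension the spectrum is exactly the set of eigenvalues. -/
def IsLowestEigenvalue {H : Type*} [NormedAddCommGroup H] [InnerProductSpace ℝ H]
    (A : H →L[ℝ] H) (μ : ℝ) : Prop :=
  IsLeast (spectrum ℝ A) μ

/-- Stochastic gradient iterates: started at `θ₀`, with step sizes `γ n` and random functions
`F n ω : H → ℝ` (`n ≥ 1`), `θ n = θ (n - 1) - γ n • (F n)'(θ (n - 1))`. -/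
def sgdIterate {Ω H : Type*} [NormedAddCommGroup H] [InnerProductSpace ℝ H] [CompleteSpace H]
    (F : ℕ → Ω → H → ℝ) (γ : ℕ → ℝ) (θ₀ : H) : ℕ → Ω → H
  | 0, _ => θ₀
  | n + 1, ω => sgdIterate F γ θ₀ n ω
      - γ (n + 1) • gradient (F (n + 1) ω) (sgdIterate F γ θ₀ n ω)

/-- The averaged iterate `(1 / n) ∑_{k = 0}^{n - 1} θ k`. -/
def sgdAverage {Ω H : Type*} [NormedAddCommGroup H] [InnerProductSpace ℝ H] [CompleteSpace H]
    (F : ℕ → Ω → H → ℝ) (γ : ℕ → ℝ) (θ₀ : H) (n : ℕ) (ω : Ω) : H :=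
  (1 / (n : ℝ)) • ∑ k ∈ Finset.range n, sgdIterate F γ θ₀ k ω

end

/-!
The argument has a deterministic and a stochastic half. Write `h = θ - θ⋆` and
`D θ = ⟪f'(θ), θ - θ⋆⟫`, which is at least `f θ - f θ⋆`; let `q v = f''(θ⋆)[v, v] ≥ μ ‖v‖²`.

**Deterministic half.** The central estimate
(`GeneralizedSelfConcordant.sqrt_mul_secondDeriv_sub_fderiv_le`) says that for all `θ` and `z`
`√μ (f''(θ⋆)[h, z] - ⟪f'(θ), z⟫) ≤ 13 R (D θ) √(q z)`.
The error in linearizing the gradient *at the minimizer* is thus controlled by `D`. Self-concordance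
is only assumed along lines, which does not imply `|f'''[z, h, h]| ≤ R ‖z‖ f''[h, h]`, so the
gradient cannot be expanded around the averaged iterate with an error independent of `μ`.
Polarization does bound `f'''[z, h, h]` by `R κ (f''[h, h] + f''[z, z])` when `‖h‖, ‖z‖ ≤ κ`. At
`θ⋆` the constant `μ` compares the two norms, so with `q z = q h` and `κ = √(q h / μ)` the sum
`f''[h, h] + f''[z, z]` obeys a Grönwall inequality along the segment from `θ⋆` to `θ`. This settles
the case `R √(q h) ≤ √μ / 2`. In the opposite case `D θ` is at least of order `μ / R²`, and it
suffices to compare `f` at `θ` and at `θ⋆ - s z` by convexity, where `√(q (s z)) = √μ / R`.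
Averaging over the iterates with `z = h̄`, the deviation of the mean, gives `√μ √(q h̄) ≤ G`, where
`G = ‖mean of f'(θ k)‖ + 13 R (mean of D (θ k))`; hence `‖h̄‖ ≤ G / μ` and
`f(θ⋆ + h̄) - f θ⋆ ≤ (3 / 2) G² / μ` (`GeneralizedSelfConcordant.average_bounds`).

**Stochastic half.** The mean of `f'(θ k)` is `(θ 0 - θ N) / (N γ)` minus the mean of the noise, and
expanding `‖θ (n + 1) - θ⋆‖²` bounds both `‖θ N - θ⋆‖²` and `2 γ ∑ D (θ k)` by the process `energy`.
So `𝔼 G² = O(R² / N)` needs only the second moment of the noise (`integral_norm_sq_sum_le`) and the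
first two moments of the energy (`integral_energy`, `integral_energy_sq_le`). The latter stay
bounded because the increments of the energy have conditional variance at most a multiple of the
energy itself.

`H` need not be separable; the iterates are nevertheless adapted, since an integrable function that
is weakly measurable for a sub-`σ`-algebra is measurable for it up to a null set
(`aestronglyMeasurable_of_inner`).
-/

/-! ### Derivatives along lines and polarization of the third derivative -/

section Calculus

variable {H : Type*} [NormedAddCommGroup H] [NormedSpace ℝ H] {f : H → ℝ}

/-- The second derivative of `f` at `x`, as a bilinear form. -/
noncomputable abbrev secondDeriv (f : H → ℝ) (x : H) : H →L[ℝ] H →L[ℝ] ℝ :=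
  fderiv ℝ (fderiv ℝ f) x

/-- The third derivative of `f` at `x`, as a trilinear form. -/
noncomputable abbrev thirdDeriv (f : H → ℝ) (x : H) : H →L[ℝ] H →L[ℝ] H →L[ℝ] ℝ :=
  fderiv ℝ (fderiv ℝ (fderiv ℝ f)) x

lemma hasDerivAt_line (x v : H) (t : ℝ) : HasDerivAt (fun s : ℝ => x + s • v) v t := by
  simpa using ((hasDerivAt_id t).smul_const v).const_add x

lemma ThreeTimesDifferentiable.hasDerivAt_line (hf : ThreeTimesDifferentiable f) (x v : H)
    (t : ℝ) : HasDerivAt (fun s : ℝ => f (x + s • v)) (fderiv ℝ f (x + t • v) v) t :=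
  (hf.1 _).hasFDerivAt.comp_hasDerivAt t (_root_.hasDerivAt_line x v t)

lemma ThreeTimesDifferentiable.hasDerivAt_fderiv_line (hf : ThreeTimesDifferentiable f)
    (x v a : H) (t : ℝ) :
    HasDerivAt (fun s : ℝ => fderiv ℝ f (x + s • v) a) (secondDeriv f (x + t • v) v a) t := by
  have h := (hf.2.1 _).hasFDerivAt.comp_hasDerivAt t (_root_.hasDerivAt_line x v t)
  simpa using h.clm_apply (hasDerivAt_const t a)

lemma ThreeTimesDifferentiable.hasDerivAt_secondDeriv_line (hf : ThreeTimesDifferentiable f)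
    (x v a b : H) (t : ℝ) :
    HasDerivAt (fun s : ℝ => secondDeriv f (x + s • v) a b)
      (thirdDeriv f (x + t • v) v a b) t := by
  have h : HasDerivAt (fun s : ℝ => secondDeriv f (x + s • v)) (thirdDeriv f (x + t • v) v) t :=
    HasFDerivAt.comp_hasDerivAt (l := fderiv ℝ (fderiv ℝ f)) t (hf.2.2 (x + t • v)).hasFDerivAt
      (_root_.hasDerivAt_line x v t)
  simpa using (h.clm_apply (hasDerivAt_const t a)).clm_apply (hasDerivAt_const t b)

lemma ThreeTimesDifferentiable.secondDeriv_comm (hf : ThreeTimesDifferentiable f) (x a b : H) :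
    secondDeriv f x a b = secondDeriv f x b a :=
  second_derivative_symmetric (fun y => (hf.1 y).hasFDerivAt) (hf.2.1 x).hasFDerivAt a b

lemma ThreeTimesDifferentiable.thirdDeriv_comm_left (hf : ThreeTimesDifferentiable f)
    (x a b c : H) : thirdDeriv f x a b c = thirdDeriv f x b a c :=
  congrArg (fun l : H →L[ℝ] ℝ => l c) <|
    second_derivative_symmetric (fun y => (hf.2.1 y).hasFDerivAt) (hf.2.2 x).hasFDerivAt a b

lemma ThreeTimesDifferentiable.thirdDeriv_comm_right (hf : ThreeTimesDifferentiable f)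
    (x a b c : H) : thirdDeriv f x a b c = thirdDeriv f x a c b := by
  have h₁ := hf.hasDerivAt_secondDeriv_line x a b c 0
  have h₂ := hf.hasDerivAt_secondDeriv_line x a c b 0
  simp only [hf.secondDeriv_comm _ c b] at h₂
  simpa using h₁.unique h₂

lemma ThreeTimesDifferentiable.iteratedDeriv_two_line (hf : ThreeTimesDifferentiable f)
    (x v : H) (t : ℝ) :
    iteratedDeriv 2 (fun s : ℝ => f (x + s • v)) t = secondDeriv f (x + t • v) v v := by
  have h₁ : deriv (fun s : ℝ => f (x + s • v)) = fun s => fderiv ℝ f (x + s • v) v :=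
    funext fun s => (hf.hasDerivAt_line x v s).deriv
  rw [iteratedDeriv_succ, iteratedDeriv_one, h₁]
  exact (hf.hasDerivAt_fderiv_line x v v t).deriv

lemma ThreeTimesDifferentiable.iteratedDeriv_three_line (hf : ThreeTimesDifferentiable f)
    (x v : H) (t : ℝ) :
    iteratedDeriv 3 (fun s : ℝ => f (x + s • v)) t = thirdDeriv f (x + t • v) v v v := by
  rw [iteratedDeriv_succ, funext (hf.iteratedDeriv_two_line x v)]
  exact (hf.hasDerivAt_secondDeriv_line x v v v t).deriv

variable {R : ℝ}

lemma GeneralizedSelfConcordant.abs_thirdDeriv_le (hsc : GeneralizedSelfConcordant R f)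
    (hf : ThreeTimesDifferentiable f) (x v : H) :
    |thirdDeriv f x v v v| ≤ R * ‖v‖ * secondDeriv f x v v := by
  have h := hsc x (x + v) 0
  simp only [add_sub_cancel_left, hf.iteratedDeriv_two_line, hf.iteratedDeriv_three_line,
    zero_smul, add_zero, sub_add_cancel_left, norm_neg] at h
  exact h

lemma ThreeTimesDifferentiable.secondDeriv_self_nonneg (hf : ThreeTimesDifferentiable f)
    (hconv : ConvexOn ℝ Set.univ f) (x v : H) : 0 ≤ secondDeriv f x v v := by
  have hc : ConvexOn ℝ Set.univ (fun s : ℝ => f (x + s • v)) := by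
    have := hconv.comp_affineMap (AffineMap.lineMap x (x + v) : ℝ →ᵃ[ℝ] H)
    simpa [Function.comp_def, AffineMap.lineMap_apply, add_comm] using this
  have hm : Monotone (fun s : ℝ => fderiv ℝ f (x + s • v) v) := by
    have := hc.monotoneOn_deriv (fun s _ => (hf.hasDerivAt_line x v s).differentiableAt)
    intro s t hst
    have h := this (Set.mem_univ s) (Set.mem_univ t) hst
    rwa [(hf.hasDerivAt_line x v s).deriv, (hf.hasDerivAt_line x v t).deriv] at h
  have h := hm.deriv_nonneg (x := 0)
  rw [(hf.hasDerivAt_fderiv_line x v v 0).deriv] at h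
  simpa using h

/-- Polarization bounds a mixed third derivative by the second derivatives in both directions. The
term `f''[a, a]` cannot be dropped: self-concordance along lines does not bound `f'''[a, b, b]` by a
multiple of `R ‖a‖ f''[b, b]`. -/
lemma GeneralizedSelfConcordant.abs_thirdDeriv_mixed_le (hsc : GeneralizedSelfConcordant R f)
    (hf : ThreeTimesDifferentiable f) (hR : 0 ≤ R) (hconv : ConvexOn ℝ Set.univ f)
    {κ : ℝ} (x a b : H) (ha : ‖a‖ ≤ κ) (hb : ‖b‖ ≤ κ) :
    |thirdDeriv f x a b b| ≤ R * κ * (secondDeriv f x a a + secondDeriv f x b b) := by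
  have hκ : 0 ≤ κ := (norm_nonneg a).trans ha
  have hab : ∀ v, ‖v‖ ≤ 2 * κ → |thirdDeriv f x v v v| ≤ R * (2 * κ) * secondDeriv f x v v :=
    fun v hv => (hsc.abs_thirdDeriv_le hf x v).trans <| by
      have := hf.secondDeriv_self_nonneg hconv x v
      gcongr
  have h₁ := hab (a + b) ((norm_add_le a b).trans (by linarith))
  have h₂ := hab (a - b) ((norm_sub_le a b).trans (by linarith))
  have h₃ : |thirdDeriv f x a a a| ≤ R * κ * secondDeriv f x a a :=
    (hsc.abs_thirdDeriv_le hf x a).trans <| by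
      have := hf.secondDeriv_self_nonneg hconv x a
      gcongr
  have hnn := mul_nonneg (mul_nonneg hR hκ) (hf.secondDeriv_self_nonneg hconv x b)
  have e₁ : thirdDeriv f x b a b = thirdDeriv f x a b b := hf.thirdDeriv_comm_left x b a b
  have e₂ : thirdDeriv f x b b a = thirdDeriv f x a b b := by
    rw [hf.thirdDeriv_comm_right, e₁]
  have e₃ : thirdDeriv f x b a a = thirdDeriv f x a b a := hf.thirdDeriv_comm_left x b a a
  have e₄ : thirdDeriv f x a a b = thirdDeriv f x a b a := hf.thirdDeriv_comm_right x a a b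
  have e₅ := hf.secondDeriv_comm x b a
  simp only [map_add, map_sub, add_apply, sub_apply,
    e₁, e₂, e₃, e₄, e₅] at h₁ h₂
  rw [abs_le] at *
  constructor <;> linarith [h₁.1, h₁.2, h₂.1, h₂.2, h₃.1, h₃.2]

end Calculus

/-! ### Linearization of the gradient at the minimizer -/

section OneVariable

lemma antitoneOn_Icc_of_hasDerivAt {u u' : ℝ → ℝ} (hu : ∀ t, HasDerivAt u (u' t) t)
    (hu' : ∀ t ∈ Set.Icc (0 : ℝ) 1, u' t ≤ 0) : AntitoneOn u (Set.Icc 0 1) :=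
  antitoneOn_of_deriv_nonpos (convex_Icc 0 1)
    (fun t _ => (hu t).continuousAt.continuousWithinAt)
    (fun t _ => (hu t).differentiableAt.differentiableWithinAt)
    fun t ht => (hu t).deriv ▸ hu' t (interior_subset ht)

/-- Taylor's inequality of order two on `[0, 1]`, from an upper bound on the second derivative. -/
lemma le_taylor_two {g g' g'' : ℝ → ℝ} {K : ℝ} (hg : ∀ t, HasDerivAt g (g' t) t)
    (hg' : ∀ t, HasDerivAt g' (g'' t) t) (hK : ∀ t ∈ Set.Icc (0 : ℝ) 1, g'' t ≤ K) :
    g 1 ≤ g 0 + g' 0 + K / 2 := by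
  have h₁ : AntitoneOn (fun t => g' t - K * t) (Set.Icc 0 1) :=
    antitoneOn_Icc_of_hasDerivAt
      (fun t => (hg' t).sub (by simpa using (hasDerivAt_id t).const_mul K))
      fun t ht => by linarith [hK t ht]
  have h₂ : AntitoneOn (fun t => g t - (g' 0 * t + K / 2 * t ^ 2)) (Set.Icc 0 1) := by
    refine antitoneOn_Icc_of_hasDerivAt (u' := fun t => g' t - (g' 0 + K * t))
      (fun t => (hg t).sub ?_) fun t ht => ?_
    · convert ((hasDerivAt_id' t).const_mul (g' 0)).fun_add
        (((hasDerivAt_id' t).fun_pow 2).const_mul (K / 2)) using 1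
      norm_num
      ring
    · have := h₁ (Set.left_mem_Icc.2 zero_le_one) ht ht.1
      simp only [mul_zero, sub_zero] at this
      linarith
  have := h₂ (Set.left_mem_Icc.2 zero_le_one) (Set.right_mem_Icc.2 zero_le_one) zero_le_one
  norm_num at this
  linarith

/-- Grönwall's inequality on `[0, 1]` in differential form. -/
lemma le_mul_exp_of_hasDerivAt_le {s s' : ℝ → ℝ} {K : ℝ} (hs : ∀ t, HasDerivAt s (s' t) t)
    (hs' : ∀ t ∈ Set.Icc (0 : ℝ) 1, s' t ≤ K * s t) {t : ℝ} (ht : t ∈ Set.Icc (0 : ℝ) 1) :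
    s t ≤ s 0 * Real.exp (K * t) := by
  have h : AntitoneOn (fun t => s t * Real.exp (-(K * t))) (Set.Icc 0 1) := by
    refine antitoneOn_Icc_of_hasDerivAt
      (u' := fun t => (s' t - K * s t) * Real.exp (-(K * t))) (fun t => ?_) fun t ht => ?_
    · have h₀ : HasDerivAt (fun t => -(K * t)) (-K) t := by
        simpa using ((hasDerivAt_id' t).const_mul K).fun_neg
      exact ((hs t).fun_mul h₀.exp).congr_deriv (by ring)
    · exact mul_nonpos_of_nonpos_of_nonneg (by linarith [hs' t ht]) (Real.exp_pos _).le
  have := h (Set.left_mem_Icc.2 zero_le_one) ht ht.1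
  simp only [mul_zero, neg_zero, Real.exp_zero, mul_one, Real.exp_neg] at this
  rwa [mul_inv_le_iff₀ (Real.exp_pos _)] at this

end OneVariable

section Linearization

variable {H : Type*} [NormedAddCommGroup H] [NormedSpace ℝ H] {f : H → ℝ} {R : ℝ}

lemma ThreeTimesDifferentiable.add_fderiv_le (hf : ThreeTimesDifferentiable f)
    (hconv : ConvexOn ℝ Set.univ f) (x v : H) : f x + fderiv ℝ f x v ≤ f (x + v) := by
  have h := le_taylor_two (fun t => (hf.hasDerivAt_line x v t).neg)
    (fun t => (hf.hasDerivAt_fderiv_line x v v t).neg) (K := 0)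
    fun t _ => neg_nonpos.2 (hf.secondDeriv_self_nonneg hconv _ v)
  simp at h
  linarith

lemma ThreeTimesDifferentiable.sub_le_fderiv (hf : ThreeTimesDifferentiable f)
    (hconv : ConvexOn ℝ Set.univ f) (x h : H) :
    f (x + h) - f x ≤ fderiv ℝ f (x + h) h := by
  have := hf.add_fderiv_le hconv (x + h) (-h)
  simp at this
  linarith

/-- A lower bound on `⟪f'(x + h), h⟫` that is quadratic for small `h` and linear for large `h`.
With `φ t = f (x + t • h)` and `ρ = R ‖h‖`, self-concordance makes `φ'' + ρ φ'` nondecreasing, hence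
`φ' + ρ φ` grows at rate at least `φ''(0)`. -/
lemma GeneralizedSelfConcordant.secondDeriv_le_fderiv_mul (hsc : GeneralizedSelfConcordant R f)
    (hf : ThreeTimesDifferentiable f) (hR : 0 ≤ R) (hconv : ConvexOn ℝ Set.univ f) {x : H}
    (hx : fderiv ℝ f x = 0) (h : H) :
    secondDeriv f x h h ≤ fderiv ℝ f (x + h) h * (1 + R * ‖h‖) := by
  set ρ := R * ‖h‖ with hρ
  have hρ0 : 0 ≤ ρ := by positivity
  have h₁ : AntitoneOn (fun t : ℝ => -(secondDeriv f (x + t • h) h h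
      + ρ * fderiv ℝ f (x + t • h) h)) (Set.Icc 0 1) :=
    antitoneOn_Icc_of_hasDerivAt
      (fun t => ((hf.hasDerivAt_secondDeriv_line x h h h t).add
        ((hf.hasDerivAt_fderiv_line x h h t).const_mul ρ)).neg)
      fun t _ => by linarith [(abs_le.1 (hsc.abs_thirdDeriv_le hf (x + t • h) h)).1]
  have h₂ : AntitoneOn (fun t : ℝ => secondDeriv f x h h * t - (fderiv ℝ f (x + t • h) h
      + ρ * f (x + t • h))) (Set.Icc 0 1) := by
    refine antitoneOn_Icc_of_hasDerivAt
      (fun t => (HasDerivAt.const_mul (secondDeriv f x h h) (hasDerivAt_id t)).sub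
        ((hf.hasDerivAt_fderiv_line x h h t).add ((hf.hasDerivAt_line x h t).const_mul ρ)))
      fun t ht => ?_
    have := h₁ (Set.left_mem_Icc.2 zero_le_one) ht ht.1
    simp [hx] at this
    linarith
  have h₃ := h₂ (Set.left_mem_Icc.2 zero_le_one) (Set.right_mem_Icc.2 zero_le_one) zero_le_one
  simp [hx] at h₃
  nlinarith [hf.sub_le_fderiv hconv x h]

/-- On the ball of radius `1 / R` around the minimizer, `f` is bounded above by its Hessian. -/
lemma GeneralizedSelfConcordant.sub_le_secondDeriv (hsc : GeneralizedSelfConcordant R f)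
    (hf : ThreeTimesDifferentiable f) (hconv : ConvexOn ℝ Set.univ f) {x : H}
    (hx : fderiv ℝ f x = 0) {v : H} (hv : R * ‖v‖ ≤ 1) :
    f (x + v) - f x ≤ Real.exp 1 / 2 * secondDeriv f x v v := by
  have hnn := fun t : ℝ => hf.secondDeriv_self_nonneg hconv (x + t • v) v
  have h₀ := hf.secondDeriv_self_nonneg hconv x v
  have hs : ∀ t ∈ Set.Icc (0 : ℝ) 1,
      secondDeriv f (x + t • v) v v ≤ secondDeriv f x v v * Real.exp 1 := fun t ht => by
    have := le_mul_exp_of_hasDerivAt_le (K := 1)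
      (hf.hasDerivAt_secondDeriv_line x v v v)
      (fun s _ => (abs_le.1 (hsc.abs_thirdDeriv_le hf _ v)).2.trans
        (mul_le_mul_of_nonneg_right hv (hnn s))) ht
    simp only [zero_smul, add_zero, one_mul] at this
    exact this.trans (by gcongr; exact ht.2)
  have := le_taylor_two (hf.hasDerivAt_line x v) (hf.hasDerivAt_fderiv_line x v v) hs
  simp [hx] at this
  linarith

/-- The linearization bound close to the minimizer, for directions `z` no longer than `h`. Here
`s t = f''(x + t h)[h, h] + f''(x + t h)[z, z]` satisfies `s' ≤ 2 R κ s`, and `s` in turn controls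
`f'''(x + t h)[z, h, h]`. -/
lemma GeneralizedSelfConcordant.secondDeriv_sub_fderiv_le_of_norm_le
    (hsc : GeneralizedSelfConcordant R f)
    (hf : ThreeTimesDifferentiable f) (hR : 0 ≤ R) (hconv : ConvexOn ℝ Set.univ f) {x : H}
    (hx : fderiv ℝ f x = 0) {h z : H} {κ : ℝ} (hh : ‖h‖ ≤ κ) (hz : ‖z‖ ≤ κ)
    (hzh : secondDeriv f x z z ≤ secondDeriv f x h h) :
    secondDeriv f x h z - fderiv ℝ f (x + h) z
      ≤ R * κ * secondDeriv f x h h * Real.exp (2 * (R * κ)) := by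
  have hκ : 0 ≤ κ := (norm_nonneg h).trans hh
  have hRκ : 0 ≤ R * κ := by positivity
  have hnnh := fun t : ℝ => hf.secondDeriv_self_nonneg hconv (x + t • h) h
  have hnnz := fun t : ℝ => hf.secondDeriv_self_nonneg hconv (x + t • h) z
  have hs : ∀ t ∈ Set.Icc (0 : ℝ) 1, secondDeriv f (x + t • h) h h + secondDeriv f (x + t • h) z z
      ≤ 2 * secondDeriv f x h h * Real.exp (2 * (R * κ)) := fun t ht => by
    have := le_mul_exp_of_hasDerivAt_le (K := 2 * (R * κ))
      (fun s => (hf.hasDerivAt_secondDeriv_line x h h h s).add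
        (hf.hasDerivAt_secondDeriv_line x h z z s))
      (fun s _ => by
        have h₁ := (abs_le.1 (hsc.abs_thirdDeriv_le hf (x + s • h) h)).2
        have h₂ := (abs_le.1
          (hsc.abs_thirdDeriv_mixed_le hf hR hconv (x + s • h) h z hh hz)).2
        have h₃ : R * ‖h‖ * secondDeriv f (x + s • h) h h
            ≤ R * κ * secondDeriv f (x + s • h) h h := by
          have := hnnh s
          gcongr
        have h₄ := mul_nonneg hRκ (hnnz s)
        simp only [Pi.add_apply]
        linarith) ht
    simp only [Pi.add_apply, zero_smul, add_zero] at this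
    have h₀ := hf.secondDeriv_self_nonneg hconv x h
    refine this.trans ?_
    exact mul_le_mul (by linarith)
      (Real.exp_le_exp.2 (mul_le_of_le_one_right (by positivity) ht.2))
      (Real.exp_pos _).le (by positivity)
  have := le_taylor_two (fun t => (hf.hasDerivAt_fderiv_line x h z t).neg)
    (fun t => (hf.hasDerivAt_secondDeriv_line x h h z t).neg)
    (K := R * κ * (2 * secondDeriv f x h h * Real.exp (2 * (R * κ)))) fun t ht => by
      have h₁ := (abs_le.1 (hsc.abs_thirdDeriv_mixed_le hf hR hconv (x + t • h) z h hz hh)).1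
      rw [hf.thirdDeriv_comm_left, hf.thirdDeriv_comm_right] at h₁
      have h₂ := mul_le_mul_of_nonneg_left (hs t ht) hRκ
      linarith
  simp [hx] at this
  linarith

end Linearization

/-! ### The central estimate and its average over the iterates -/

section Averaging

variable {H : Type*} [NormedAddCommGroup H] [NormedSpace ℝ H] {f : H → ℝ} {R : ℝ}

/-- Cauchy–Schwarz for the Hessian form. -/
lemma ThreeTimesDifferentiable.secondDeriv_le_sqrt_mul_sqrt (hf : ThreeTimesDifferentiable f)
    (hconv : ConvexOn ℝ Set.univ f) (x a b : H) :
    secondDeriv f x a b ≤ √(secondDeriv f x a a) * √(secondDeriv f x b b) := by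
  have ha := hf.secondDeriv_self_nonneg hconv x a
  rw [← Real.sqrt_mul ha]
  refine Real.le_sqrt_of_sq_le ?_
  have hd := discrim_le_zero (a := secondDeriv f x b b) (b := 2 * secondDeriv f x a b)
    (c := secondDeriv f x a a) fun t => by
      have := hf.secondDeriv_self_nonneg hconv x (a + t • b)
      simp only [map_add, map_smul, add_apply, smul_apply, smul_eq_mul,
        hf.secondDeriv_comm x b a] at this
      linarith
  rw [discrim] at hd
  linarith

/-- The gradient at `x + h` is its linearization at the minimizer `x` up to an error controlled by
`⟪f'(x + h), h⟫`, uniformly in `h`. The error is measured in the norm dual to the one defined by the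
Hessian at `x`, in which `f''(x) h` has size `√(f''(x)[h, h])`. -/
lemma GeneralizedSelfConcordant.sqrt_mul_secondDeriv_sub_fderiv_le
    (hsc : GeneralizedSelfConcordant R f)
    (hf : ThreeTimesDifferentiable f) (hR : 0 < R) (hconv : ConvexOn ℝ Set.univ f) {x : H}
    (hx : fderiv ℝ f x = 0) {μ : ℝ} (hμ : 0 < μ)
    (hq : ∀ v, μ * ‖v‖ ^ 2 ≤ secondDeriv f x v v) (h z : H) :
    √μ * (secondDeriv f x h z - fderiv ℝ f (x + h) z)
      ≤ 13 * R * fderiv ℝ f (x + h) h * √(secondDeriv f x z z) := by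
  have hnn := hf.secondDeriv_self_nonneg hconv x
  have hsμ : 0 < √μ := Real.sqrt_pos.2 hμ
  have hnorm : ∀ v, √μ * ‖v‖ ≤ √(secondDeriv f x v v) := fun v => by
    refine Real.le_sqrt_of_sq_le ?_
    rw [mul_pow, Real.sq_sqrt hμ.le]
    exact hq v
  have hpos : ∀ v, v ≠ 0 → 0 < √(secondDeriv f x v v) := fun v hv =>
    (mul_pos hsμ (norm_pos_iff.2 hv)).trans_le (hnorm v)
  rcases eq_or_ne z 0 with rfl | hz
  · simp
  rcases eq_or_ne h 0 with rfl | hh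
  · simp [hx]
  set a := √(secondDeriv f x h h) with ha
  set b := √(secondDeriv f x z z) with hb
  set D := fderiv ℝ f (x + h) h with hD
  have ha0 : 0 < a := hpos h hh
  have hb0 : 0 < b := hpos z hz
  have ha2 : secondDeriv f x h h = a ^ 2 := (Real.sq_sqrt (hnn h)).symm
  have hb2 : secondDeriv f x z z = b ^ 2 := (Real.sq_sqrt (hnn z)).symm
  have hDlow : a ^ 2 ≤ D * (1 + R * ‖h‖) :=
    ha2 ▸ hsc.secondDeriv_le_fderiv_mul hf hR.le hconv hx h
  have hD0 : 0 < D := by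
    have : 0 < 1 + R * ‖h‖ := by positivity
    exact pos_of_mul_pos_left ((pow_pos ha0 2).trans_le hDlow) this.le
  -- `y` is the length of `h` in the Hessian norm, in units of `√μ / R`
  obtain ⟨y, hy⟩ : ∃ y, y = R * a / √μ := ⟨_, rfl⟩
  have hya : a = √μ / R * y := by rw [hy]; field_simp
  have hy0 : 0 < y := by rw [hy]; positivity
  have hRh : R * ‖h‖ ≤ y := by
    rw [hy, le_div_iff₀ hsμ]
    nlinarith [hnorm h]
  have he := Real.exp_one_lt_d9
  have hDy : a ^ 2 ≤ D * (1 + y) := hDlow.trans (by gcongr)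
  rcases le_total y (1 / 2) with hy' | hy'
  · -- close to the minimizer: rescale `z` to the Hessian length of `h`
    have hc : 0 < a / b := by positivity
    have hzn : ‖(a / b) • z‖ ≤ a / √μ := by
      rw [norm_smul, Real.norm_of_nonneg hc.le, div_mul_eq_mul_div, div_le_div_iff₀ hb0 hsμ]
      nlinarith [hnorm z]
    have hhn : ‖h‖ ≤ a / √μ := by
      rw [le_div_iff₀ hsμ, mul_comm]
      exact hnorm h
    have key := hsc.secondDeriv_sub_fderiv_le_of_norm_le hf hR.le hconv hx hhn hzn (by
      simp only [map_smul, smul_apply, smul_eq_mul, hb2, ha2]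
      field_simp
      rfl)
    simp only [map_smul, smul_eq_mul, ha2, ← mul_div_assoc R, ← hy, ← mul_sub] at key
    have hexp : Real.exp (2 * y) ≤ Real.exp 1 := Real.exp_le_exp.2 (by linarith)
    have h₁ : y * a ^ 2 * Real.exp (2 * y) ≤ y * (D * (1 + 1 / 2)) * 3 := by
      gcongr
      · exact hDy.trans (by gcongr)
      · linarith
    have h₂ : a / b * (secondDeriv f x h z - fderiv ℝ f (x + h) z) ≤ 13 * D * y :=
      key.trans (h₁.trans (by nlinarith [mul_pos hy0 hD0]))
    rw [hy, div_mul_eq_mul_div, ← mul_div_assoc, div_le_div_iff₀ hb0 hsμ] at h₂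
    refine le_of_mul_le_mul_left ?_ ha0
    linarith
  · -- far from the minimizer: compare `f` at `x + h` and at `x - c z`, where `c` is as large as
    -- the quadratic upper bound `sub_le_secondDeriv` allows
    obtain ⟨c, hc⟩ : ∃ c, c = √μ / (R * b) := ⟨_, rfl⟩
    have hc0 : 0 < c := by rw [hc]; positivity
    have hcn : R * ‖-(c • z)‖ ≤ 1 := by
      rw [norm_neg, norm_smul, Real.norm_of_nonneg hc0.le, hc, div_mul_eq_mul_div, ← mul_div_assoc,
        div_le_one (by positivity)]
      nlinarith [hnorm z]
    have h₁ := hsc.sub_le_secondDeriv hf hconv hx hcn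
    have h₂ := hf.add_fderiv_le hconv (x + h) (-(c • z) - h)
    -- `f x ≤ f (x + h)`
    have h₃ := hf.add_fderiv_le hconv x h
    have h₄ := hf.secondDeriv_le_sqrt_mul_sqrt hconv x h z
    rw [show x + h + (-(c • z) - h) = x + -(c • z) by abel] at h₂
    simp only [map_sub, map_neg, map_smul, neg_apply, smul_apply, smul_eq_mul, hb2, hx,
      zero_apply] at h₁ h₂ h₃
    have hμR : c * (c * b ^ 2) = (√μ / R) ^ 2 := by rw [hc]; field_simp
    have hcab : c * (a * b) = (√μ / R) ^ 2 * y := by rw [hc, hya]; field_simp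
    have h₅ : c * secondDeriv f x h z ≤ (√μ / R) ^ 2 * y := by
      rw [← hcab]
      exact mul_le_mul_of_nonneg_left h₄ hc0.le
    have h₆ : c * (secondDeriv f x h z - fderiv ℝ f (x + h) z) ≤ 13 * D := by
      rw [hya, mul_pow] at hDy
      set w := (√μ / R) ^ 2 with hw
      have hw0 : 0 < w := by positivity
      have h₇ : w * (y + 1.36) ≤ 12 * D := by
        refine le_of_mul_le_mul_right ?_ (by linarith : 0 < 1 + y)
        nlinarith [mul_nonneg hw0.le (sub_nonneg.2 hy'), mul_nonneg hw0.le
          (mul_nonneg (sub_nonneg.2 hy') (sub_nonneg.2 hy'))]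
      have h₈ : Real.exp 1 / 2 * w ≤ 1.36 * w := by
        gcongr
        linarith
      simp only [mul_neg, neg_neg, hμR] at h₁
      linarith
    rw [hc, div_mul_eq_mul_div, div_le_iff₀ (by positivity)] at h₆
    linarith

/-- Averaging the linearization bound in the direction `z = h̄`: the gradients at the points
`x + h k` control the deviation `h̄` of their mean from `x`, in the norm of the Hessian at `x`. -/
lemma GeneralizedSelfConcordant.sqrt_secondDeriv_average_le
    (hsc : GeneralizedSelfConcordant R f)
    (hf : ThreeTimesDifferentiable f) (hR : 0 < R) (hconv : ConvexOn ℝ Set.univ f) {x : H}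
    (hx : fderiv ℝ f x = 0) {μ : ℝ} (hμ : 0 < μ)
    (hq : ∀ v, μ * ‖v‖ ^ 2 ≤ secondDeriv f x v v) {N : ℕ} (hN : 0 < N) (h : ℕ → H) {hbar : H}
    (hbar_eq : (N : ℝ) • hbar = ∑ k ∈ Finset.range N, h k) :
    N * (√μ * √(secondDeriv f x hbar hbar))
      ≤ ‖∑ k ∈ Finset.range N, fderiv ℝ f (x + h k)‖
        + 13 * R * ∑ k ∈ Finset.range N, fderiv ℝ f (x + h k) (h k) := by
  have hsμ : 0 < √μ := Real.sqrt_pos.2 hμ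
  have hN' : (0 : ℝ) < N := Nat.cast_pos.2 hN
  have hb2 := Real.sq_sqrt (hf.secondDeriv_self_nonneg hconv x hbar)
  have hnorm : √μ * ‖hbar‖ ≤ √(secondDeriv f x hbar hbar) := by
    refine Real.le_sqrt_of_sq_le ?_
    rw [mul_pow, Real.sq_sqrt hμ.le]
    exact hq hbar
  have hsum := Finset.sum_le_sum fun k (_ : k ∈ Finset.range N) =>
    hsc.sqrt_mul_secondDeriv_sub_fderiv_le hf hR hconv hx hμ hq (h k) hbar
  rw [← Finset.mul_sum, Finset.sum_sub_distrib, ← Finset.sum_mul, ← Finset.mul_sum] at hsum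
  have e₁ : ∑ k ∈ Finset.range N, secondDeriv f x (h k) hbar
      = N * secondDeriv f x hbar hbar := by
    rw [← sum_apply, ← map_sum, ← hbar_eq]
    simp
  have e₂ : ∑ k ∈ Finset.range N, fderiv ℝ f (x + h k) hbar
      ≤ ‖∑ k ∈ Finset.range N, fderiv ℝ f (x + h k)‖ * ‖hbar‖ := by
    rw [← sum_apply]
    exact (Real.le_norm_self _).trans (ContinuousLinearMap.le_opNorm _ _)
  rw [e₁] at hsum
  rcases (Real.sqrt_nonneg (secondDeriv f x hbar hbar)).eq_or_lt with h0 | h0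
  · rw [← h0, mul_zero, mul_zero]
    have : ∀ k, 0 ≤ fderiv ℝ f (x + h k) (h k) := fun k => by
      have h₁ := hf.sub_le_fderiv hconv x (h k)
      have h₂ := hf.add_fderiv_le hconv x (h k)
      rw [hx, zero_apply] at h₂
      linarith
    have := Finset.sum_nonneg fun k (_ : k ∈ Finset.range N) => this k
    positivity
  · refine le_of_mul_le_mul_right ?_ h0
    have e₃ : N * (√μ * √(secondDeriv f x hbar hbar)) * √(secondDeriv f x hbar hbar)
        = √μ * (N * secondDeriv f x hbar hbar) := by
      linear_combination √μ * N * hb2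
    rw [e₃]
    nlinarith [mul_le_mul_of_nonneg_left e₂ hsμ.le, mul_le_mul_of_nonneg_left hnorm
      (norm_nonneg (∑ k ∈ Finset.range N, fderiv ℝ f (x + h k)))]

/-- The two quantities of interest at the averaged point, in terms of the averaged gradient and of
the averaged values of `⟪f'(x + h), h⟫`. -/
lemma GeneralizedSelfConcordant.average_bounds
    (hsc : GeneralizedSelfConcordant R f)
    (hf : ThreeTimesDifferentiable f) (hR : 0 < R) (hconv : ConvexOn ℝ Set.univ f) {x : H}
    (hx : fderiv ℝ f x = 0) {μ : ℝ} (hμ : 0 < μ)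
    (hq : ∀ v, μ * ‖v‖ ^ 2 ≤ secondDeriv f x v v) {N : ℕ} (hN : 0 < N) (h : ℕ → H) {hbar : H}
    (hbar_eq : (N : ℝ) • hbar = ∑ k ∈ Finset.range N, h k) {G : ℝ}
    (hG : ‖∑ k ∈ Finset.range N, fderiv ℝ f (x + h k)‖
        + 13 * R * ∑ k ∈ Finset.range N, fderiv ℝ f (x + h k) (h k) ≤ N * G) :
    ‖hbar‖ ^ 2 ≤ G ^ 2 / μ ^ 2 ∧ f (x + hbar) - f x ≤ 3 / 2 * (G ^ 2 / μ) := by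
  have hsμ : 0 < √μ := Real.sqrt_pos.2 hμ
  have hN' : (0 : ℝ) < N := Nat.cast_pos.2 hN
  have hb0 := hf.secondDeriv_self_nonneg hconv x hbar
  have hGle : √μ * √(secondDeriv f x hbar hbar) ≤ G :=
    le_of_mul_le_mul_left
      ((hsc.sqrt_secondDeriv_average_le hf hR hconv hx hμ hq hN h hbar_eq).trans hG) hN'
  have hG0 : 0 ≤ G := (by positivity : 0 ≤ √μ * √(secondDeriv f x hbar hbar)).trans hGle
  have hqG : μ * secondDeriv f x hbar hbar ≤ G ^ 2 := by
    have := pow_le_pow_left₀ (by positivity) hGle 2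
    rwa [mul_pow, Real.sq_sqrt hμ.le, Real.sq_sqrt hb0] at this
  have hnorm2 : (μ * ‖hbar‖) ^ 2 ≤ G ^ 2 := by nlinarith [hq hbar]
  have hnorm : μ * ‖hbar‖ ≤ G := le_of_sq_le_sq hnorm2 hG0
  refine ⟨by rw [le_div_iff₀ (by positivity)]; linarith, ?_⟩
  rw [← mul_div_assoc, le_div_iff₀ hμ]
  rcases le_total (R * ‖hbar‖) 1 with h1 | h1
  · have h₁ := hsc.sub_le_secondDeriv hf hconv hx h1
    have he := Real.exp_one_lt_d9
    have h₂ : Real.exp 1 / 2 * secondDeriv f x hbar hbar ≤ 3 / 2 * secondDeriv f x hbar hbar := by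
      gcongr
      linarith
    nlinarith
  · have hjensen : N * (f (x + hbar) - f x)
        ≤ ∑ k ∈ Finset.range N, fderiv ℝ f (x + h k) (h k) := by
      have h₁ : ∑ k ∈ Finset.range N, (f (x + hbar) + fderiv ℝ f (x + hbar) (h k - hbar) - f x)
          ≤ ∑ k ∈ Finset.range N, fderiv ℝ f (x + h k) (h k) :=
        Finset.sum_le_sum fun k _ => by
          have h₁ := hf.add_fderiv_le hconv (x + hbar) (h k - hbar)
          have h₂ := hf.sub_le_fderiv hconv x (h k)
          rw [add_add_sub_cancel] at h₁
          linarith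
      rw [Finset.sum_sub_distrib, Finset.sum_add_distrib, ← map_sum, Finset.sum_sub_distrib,
        ← hbar_eq] at h₁
      simp at h₁
      linarith
    have h₂ : 13 * R * (N * (f (x + hbar) - f x)) ≤ N * G := by
      have := mul_le_mul_of_nonneg_left hjensen (by positivity : 0 ≤ 13 * R)
      have := norm_nonneg (∑ k ∈ Finset.range N, fderiv ℝ f (x + h k))
      linarith
    have h₃ : 13 * R * (f (x + hbar) - f x) ≤ G := by
      refine le_of_mul_le_mul_left ?_ hN'
      linarith
    have h₄ : 0 ≤ f (x + hbar) - f x := by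
      have h₂ := hf.add_fderiv_le hconv x hbar
      rw [hx, zero_apply] at h₂
      linarith
    -- `1 ≤ R ‖h̄‖` supplies the missing factor `G / μ`
    have h₅ : μ ≤ R * G := by
      have := mul_le_mul_of_nonneg_left h1 hμ.le
      have := mul_le_mul_of_nonneg_left hnorm hR.le
      linarith
    calc (f (x + hbar) - f x) * μ ≤ (f (x + hbar) - f x) * (R * G) := by gcongr
      _ ≤ 13 * R * (f (x + hbar) - f x) * G := by
        nlinarith [mul_nonneg (mul_nonneg h₄ hR.le) hG0]
      _ ≤ G * G := by gcongr
      _ ≤ 3 / 2 * G ^ 2 := by nlinarith [sq_nonneg G]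

end Averaging

/-! ### The gradient, the Hessian and its lowest eigenvalue -/

section Hessian

variable {H : Type*} [NormedAddCommGroup H] [InnerProductSpace ℝ H] [CompleteSpace H]

lemma inner_gradient (f : H → ℝ) (x v : H) : inner ℝ (gradient f x) v = fderiv ℝ f x v := by
  rw [gradient, InnerProductSpace.toDual_symm_apply]

/-- The Riesz isomorphism from the dual, as a continuous linear map; `InnerProductSpace.toDual` is
bundled as a conjugate-linear map even over `ℝ`, which the chain rule for `fderiv` does not take. -/
noncomputable def rieszInv : StrongDual ℝ H →L[ℝ] H where
  toFun l := (InnerProductSpace.toDual ℝ H).symm l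
  map_add' := by simp
  map_smul' := by simp
  cont := (InnerProductSpace.toDual ℝ H).symm.continuous

lemma ThreeTimesDifferentiable.inner_hessian {f : H → ℝ} (hf : ThreeTimesDifferentiable f)
    (x v w : H) : inner ℝ (hessian f x v) w = secondDeriv f x v w := by
  have h : HasFDerivAt (gradient f) ((rieszInv (H := H)).comp (secondDeriv f x)) x :=
    (rieszInv (H := H)).hasFDerivAt.comp x (hf.2.1 x).hasFDerivAt
  rw [hessian, h.fderiv]
  exact InnerProductSpace.toDual_symm_apply

lemma ThreeTimesDifferentiable.continuous_gradient {f : H → ℝ}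
    (hf : ThreeTimesDifferentiable f) : Continuous (gradient f) :=
  (InnerProductSpace.toDual ℝ H).symm.continuous.comp hf.2.1.continuous

/-- The least point of the spectrum of a self-adjoint operator bounds its quadratic form from
below: for `c = ‖A‖`, the norm of `c - A` is its spectral radius, which is at most `c - μ`. -/
lemma IsLowestEigenvalue.mul_sq_norm_le_inner {A : H →L[ℝ] H} (hA : IsSelfAdjoint A) {μ : ℝ}
    (hμ : IsLowestEigenvalue A μ) (v : H) : μ * ‖v‖ ^ 2 ≤ inner ℝ (A v) v := by
  set c := ‖A‖ * ‖(1 : H →L[ℝ] H)‖ with hc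
  have hk : ∀ k ∈ spectrum ℝ A, k ≤ c := fun k hk =>
    (Real.le_norm_self k).trans (spectrum.norm_le_norm_mul_of_mem hk)
  have hcμ : 0 ≤ c - μ := sub_nonneg.2 (hk μ hμ.1)
  have hB : IsSelfAdjoint (algebraMap ℝ (H →L[ℝ] H) c - A) :=
    (IsSelfAdjoint.algebraMap _ (IsSelfAdjoint.all c)).sub hA
  have hr : (‖algebraMap ℝ (H →L[ℝ] H) c - A‖₊ : ENNReal) ≤ (c - μ).toNNReal := by
    rw [← ContinuousLinearMap.spectralRadius_eq_nnnorm _ hB]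
    refine iSup₂_le fun k hkB => ?_
    rw [← spectrum.singleton_sub_eq] at hkB
    obtain ⟨_, rfl, l, hl, rfl⟩ := hkB
    rw [ENNReal.coe_le_coe, ← NNReal.coe_le_coe, Real.coe_toNNReal _ hcμ, coe_nnnorm,
      Real.norm_of_nonneg (sub_nonneg.2 (hk l hl))]
    exact sub_le_sub_left (hμ.2 hl) _
  rw [ENNReal.coe_le_coe, ← NNReal.coe_le_coe, Real.coe_toNNReal _ hcμ, coe_nnnorm] at hr
  have h₁ : inner ℝ ((algebraMap ℝ (H →L[ℝ] H) c - A) v) v ≤ (c - μ) * ‖v‖ * ‖v‖ :=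
    (real_inner_le_norm _ _).trans (by gcongr; exact ContinuousLinearMap.le_of_opNorm_le _ hr v)
  have h₂ : inner ℝ ((algebraMap ℝ (H →L[ℝ] H) c - A) v) v = c * ‖v‖ ^ 2 - inner ℝ (A v) v := by
    rw [← real_inner_self_eq_norm_sq, ← real_inner_smul_left, ← inner_sub_left]
    simp [Algebra.algebraMap_eq_smul_one]
  rw [h₂] at h₁
  linarith

lemma ThreeTimesDifferentiable.mul_sq_norm_le_secondDeriv {f : H → ℝ}
    (hf : ThreeTimesDifferentiable f) {x : H} {μ : ℝ} (hμ : IsLowestEigenvalue (hessian f x) μ)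
    (v : H) : μ * ‖v‖ ^ 2 ≤ secondDeriv f x v v := by
  rw [← hf.inner_hessian]
  refine hμ.mul_sq_norm_le_inner ?_ v
  rw [ContinuousLinearMap.isSelfAdjoint_iff_isSymmetric]
  intro a b
  rw [real_inner_comm _ a]
  exact (hf.inner_hessian x a b).trans
    ((hf.secondDeriv_comm x a b).trans (hf.inner_hessian x b a).symm)

end Hessian

/-! ### Measurability of the iterates -/

section Measurability

variable {H : Type*} [NormedAddCommGroup H] {Ω : Type*}

lemma measurable_apply_of_stronglyMeasurable {m : MeasurableSpace Ω} {G : Ω → H → ℝ}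
    (hGc : ∀ ω, Continuous (G ω)) (hGm : ∀ θ, Measurable fun ω => G ω θ) {θ : Ω → H}
    (hθ : StronglyMeasurable θ) : Measurable fun ω => G ω (θ ω) := by
  have hs : ∀ s : SimpleFunc Ω H, Measurable fun ω => G ω (s ω) := fun s B hB => by
    have : (fun ω => G ω (s ω)) ⁻¹' B
        = ⋃ y ∈ s.range, s ⁻¹' {y} ∩ (fun ω => G ω y) ⁻¹' B := by
      ext ω
      simp only [Set.mem_preimage, Set.mem_iUnion, Set.mem_inter_iff, Set.mem_singleton_iff,
        exists_prop]
      exact ⟨fun h => ⟨s ω, s.mem_range_self ω, rfl, h⟩, fun ⟨y, _, hy, h⟩ => by rwa [hy]⟩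
    rw [this]
    exact s.range.measurableSet_biUnion fun y _ =>
      (s.measurableSet_preimage {y}).inter (hGm y hB)
  exact measurable_of_tendsto_metrizable (fun n => hs (hθ.approx n)) <|
    tendsto_pi_nhds.2 fun ω => ((hGc ω).tendsto _).comp (hθ.tendsto_approx ω)

variable [InnerProductSpace ℝ H] [CompleteSpace H]

/-- The gradient of a random function at a random point is weakly measurable, as a limit of
difference quotients. -/
lemma measurable_inner_gradient {m : MeasurableSpace Ω} {G : Ω → H → ℝ}
    (hGd : ∀ ω, Differentiable ℝ (G ω)) (hGm : ∀ θ, Measurable fun ω => G ω θ) {θ : Ω → H}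
    (hθ : StronglyMeasurable θ) (v : H) :
    Measurable fun ω => inner ℝ (gradient (G ω) (θ ω)) v := by
  refine measurable_of_tendsto_metrizable (f := fun (n : ℕ) ω =>
      (n : ℝ) • (G ω (θ ω + (n : ℝ)⁻¹ • v) - G ω (θ ω))) (fun n => ?_)
    (tendsto_pi_nhds.2 fun ω => ?_)
  · exact ((measurable_apply_of_stronglyMeasurable (fun ω => (hGd ω).continuous) hGm
      (hθ.add_const _)).sub (measurable_apply_of_stronglyMeasurable
        (fun ω => (hGd ω).continuous) hGm hθ)).const_smul (n : ℝ)
  · rw [inner_gradient]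
    exact ((hGd ω (θ ω)).hasFDerivAt.lim_real v).comp tendsto_natCast_atTop_atTop

/-- A form of Pettis' theorem: an integrable function that is weakly measurable for a
sub-`σ`-algebra coincides with its conditional expectation. -/
lemma aestronglyMeasurable_of_inner {m m0 : MeasurableSpace Ω} {P : Measure Ω}
    [IsFiniteMeasure P] (hm : m ≤ m0) {g : Ω → H} (hg : Integrable g P)
    (hgw : ∀ v, AEStronglyMeasurable[m] (fun ω => inner ℝ (g ω) v) P) :
    AEStronglyMeasurable[m] g P := by
  have hdiff : Integrable (g - P[g | m]) P := hg.sub integrable_condExp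
  obtain ⟨t, ht, hgt⟩ := hdiff.aestronglyMeasurable.isSeparable_ae_range
  have h0 : g - P[g | m] =ᵐ[P] 0 := by
    refine ae_eq_zero_of_forall_dual_of_isSeparable ℝ ht (fun c => ?_) hgt
    have hc : AEStronglyMeasurable[m] (fun ω => c (g ω)) P := by
      refine (hgw ((InnerProductSpace.toDual ℝ H).symm c)).congr (.of_forall fun ω => ?_)
      change inner ℝ (g ω) _ = c (g ω)
      rw [real_inner_comm]
      exact InnerProductSpace.toDual_symm_apply
    filter_upwards [c.comp_condExp_comm (m := m) hg,
      condExp_of_aestronglyMeasurable' hm hc (c.integrable_comp hg)] with ω h₁ h₂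
    have h₃ : c (P[g | m] ω) = c (g ω) := h₁.trans h₂
    simp [h₃]
  refine stronglyMeasurable_condExp.aestronglyMeasurable.congr (f := P[g | m]) ?_
  filter_upwards [h0] with ω hω
  exact (sub_eq_zero.1 hω).symm

lemma aestronglyMeasurable_gradient {m m0 : MeasurableSpace Ω} {P : Measure Ω}
    [IsFiniteMeasure P] (hm : m ≤ m0) {G : Ω → H → ℝ}
    (hGd : ∀ ω, Differentiable ℝ (G ω)) (hGm : ∀ θ, Measurable[m] fun ω => G ω θ) {θ : Ω → H}
    (hθ : AEStronglyMeasurable[m] θ P)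
    (hint : Integrable (fun ω => gradient (G ω) (θ ω)) P) :
    AEStronglyMeasurable[m] (fun ω => gradient (G ω) (θ ω)) P := by
  refine aestronglyMeasurable_of_inner hm hint fun v => ?_
  refine (measurable_inner_gradient hGd hGm hθ.stronglyMeasurable_mk
    v).stronglyMeasurable.aestronglyMeasurable.congr ?_
  filter_upwards [hθ.ae_eq_mk] with ω hω
  rw [hω]

lemma aestronglyMeasurable_sgdIterate {m0 : MeasurableSpace Ω} {P : Measure Ω}
    [IsFiniteMeasure P] {ℱ : Filtration ℕ m0} {F : ℕ → Ω → H → ℝ} {γ : ℕ → ℝ} {θ₀ : H}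
    (hFdiff : ∀ n ≥ 1, ∀ ω, Differentiable ℝ (F n ω))
    (hFmeas : ∀ n ≥ 1, ∀ θ, Measurable[ℱ n] fun ω => F n ω θ)
    (hFint : ∀ n ≥ 1,
      Integrable (fun ω => gradient (F n ω) (sgdIterate F γ θ₀ (n - 1) ω)) P) (n : ℕ) :
    AEStronglyMeasurable[ℱ n] (sgdIterate F γ θ₀ n) P := by
  induction n with
  | zero => exact aestronglyMeasurable_const
  | succ n ih =>
    have ih' : AEStronglyMeasurable[ℱ (n + 1)] (sgdIterate F γ θ₀ n) P :=
      ih.mono (ℱ.mono n.le_succ)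
    exact ih'.sub ((aestronglyMeasurable_gradient (ℱ.le _) (hFdiff _ n.succ_pos)
      (hFmeas _ n.succ_pos) ih' (hFint (n + 1) n.succ_pos)).const_smul _)

end Measurability

/-! ### Moments of the stochastic recursion -/

section Bounded

variable {Ω E H : Type*} [NormedAddCommGroup E] [NormedAddCommGroup H]
  [InnerProductSpace ℝ H] {m m' m0 : MeasurableSpace Ω} {P : Measure Ω}

/-- `X` is, up to a null set, `m`-measurable and bounded. -/
def IsBoundedMeasurable {E : Type*} [NormedAddCommGroup E] (m : MeasurableSpace Ω)
    {m0 : MeasurableSpace Ω} (P : Measure Ω) (X : Ω → E) : Prop :=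
  AEStronglyMeasurable[m] X P ∧ ∃ C : ℝ, ∀ᵐ ω ∂P, ‖X ω‖ ≤ C

namespace IsBoundedMeasurable

lemma const (c : E) : IsBoundedMeasurable m P fun _ => c :=
  ⟨aestronglyMeasurable_const, ‖c‖, .of_forall fun _ => le_rfl⟩

lemma mono {X : Ω → E} (hX : IsBoundedMeasurable m P X) (h : m ≤ m') :
    IsBoundedMeasurable m' P X :=
  ⟨hX.1.mono h, hX.2⟩

lemma add {X Y : Ω → E} (hX : IsBoundedMeasurable m P X) (hY : IsBoundedMeasurable m P Y) :
    IsBoundedMeasurable m P fun ω => X ω + Y ω := by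
  obtain ⟨C, hC⟩ := hX.2
  obtain ⟨D, hD⟩ := hY.2
  refine ⟨hX.1.add hY.1, C + D, ?_⟩
  filter_upwards [hC, hD] with ω h₁ h₂
  exact (norm_add_le _ _).trans (add_le_add h₁ h₂)

lemma smul [NormedSpace ℝ E] {a : Ω → ℝ} {X : Ω → E} (ha : IsBoundedMeasurable m P a)
    (hX : IsBoundedMeasurable m P X) : IsBoundedMeasurable m P fun ω => a ω • X ω := by
  obtain ⟨C, hC⟩ := ha.2
  obtain ⟨D, hD⟩ := hX.2
  refine ⟨ha.1.smul hX.1, C * D, ?_⟩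
  filter_upwards [hC, hD] with ω h₁ h₂
  rw [norm_smul]
  exact mul_le_mul h₁ h₂ (norm_nonneg _) ((norm_nonneg _).trans h₁)

lemma sub {X Y : Ω → E} (hX : IsBoundedMeasurable m P X) (hY : IsBoundedMeasurable m P Y) :
    IsBoundedMeasurable m P fun ω => X ω - Y ω := by
  obtain ⟨C, hC⟩ := hX.2
  obtain ⟨D, hD⟩ := hY.2
  refine ⟨hX.1.sub hY.1, C + D, ?_⟩
  filter_upwards [hC, hD] with ω h₁ h₂
  exact (norm_sub_le _ _).trans (add_le_add h₁ h₂)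

lemma mul {X Y : Ω → ℝ} (hX : IsBoundedMeasurable m P X) (hY : IsBoundedMeasurable m P Y) :
    IsBoundedMeasurable m P fun ω => X ω * Y ω :=
  hX.smul hY

lemma inner {X Y : Ω → H} (hX : IsBoundedMeasurable m P X) (hY : IsBoundedMeasurable m P Y) :
    IsBoundedMeasurable m P fun ω => inner ℝ (X ω) (Y ω) := by
  obtain ⟨C, hC⟩ := hX.2
  obtain ⟨D, hD⟩ := hY.2
  refine ⟨hX.1.inner hY.1, C * D, ?_⟩
  filter_upwards [hC, hD] with ω h₁ h₂
  exact (norm_inner_le_norm _ _).trans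
    (mul_le_mul h₁ h₂ (norm_nonneg _) ((norm_nonneg _).trans h₁))

lemma sq {X : Ω → ℝ} (hX : IsBoundedMeasurable m P X) :
    IsBoundedMeasurable m P fun ω => X ω ^ 2 := by
  simpa [pow_two] using hX.mul hX

lemma norm_sq {X : Ω → H} (hX : IsBoundedMeasurable m P X) :
    IsBoundedMeasurable m P fun ω => ‖X ω‖ ^ 2 := by
  simpa [real_inner_self_eq_norm_sq] using hX.inner hX

lemma sum {X : ℕ → Ω → E} {n : ℕ} (hX : ∀ k < n, IsBoundedMeasurable m P (X k)) :
    IsBoundedMeasurable m P fun ω => ∑ k ∈ Finset.range n, X k ω := by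
  induction n with
  | zero => simpa using const (0 : E)
  | succ n ih =>
    simp only [Finset.sum_range_succ]
    exact (ih fun k hk => hX k (hk.trans n.lt_succ_self)).add (hX n n.lt_succ_self)

lemma integrable [IsFiniteMeasure P] (hm : m ≤ m0) {X : Ω → E}
    (hX : IsBoundedMeasurable m P X) : Integrable X P := by
  obtain ⟨C, hC⟩ := hX.2
  exact .of_bound (hX.1.mono hm) C hC

end IsBoundedMeasurable

lemma integral_inner_eq_zero_of_condExp [CompleteSpace H] [IsFiniteMeasure P] (hm : m ≤ m0)
    {X Y : Ω → H}
    (hY : IsBoundedMeasurable m P Y) (hX : Integrable X P) (h0 : P[X | m] =ᵐ[P] 0) :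
    ∫ ω, inner ℝ (Y ω) (X ω) ∂P = 0 := by
  obtain ⟨C, hC⟩ := hY.2
  have h := condExp_aestronglyMeasurable_bilin_of_bound (innerSL ℝ (E := H)) hm hY.1 hX C hC
  have h' : ∫ ω, P[fun ω => innerSL ℝ (Y ω) (X ω) | m] ω ∂P = 0 := by
    refine integral_eq_zero_of_ae ?_
    filter_upwards [h, h0] with ω h₁ h₂
    rw [h₁, h₂]
    simp
  rwa [integral_condExp hm] at h'

end Bounded

section Energy

variable {H : Type*} [NormedAddCommGroup H] [InnerProductSpace ℝ H] {Ω : Type*}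

/-- An upper bound for `‖θ n - θ⋆‖²` along the recursion, with the drift dropped: `X k` is the noise
in the gradient at step `k`, `h k = θ k - θ⋆`, and each step contributes at most `(γ R)²`. -/
noncomputable def energy (h X : ℕ → Ω → H) (γ R : ℝ) (n : ℕ) (ω : Ω) : ℝ :=
  ‖h 0 ω‖ ^ 2 + n * (γ * R) ^ 2
    - 2 * γ * ∑ k ∈ Finset.range n, inner ℝ (h k ω) (X k ω)

lemma energy_succ (h X : ℕ → Ω → H) (γ R : ℝ) (n : ℕ) (ω : Ω) :
    energy h X γ R (n + 1) ω
      = energy h X γ R n ω + (γ * R) ^ 2 - 2 * γ * inner ℝ (h n ω) (X n ω) := by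
  simp only [energy, Finset.sum_range_succ]
  push_cast
  ring

variable {h X : ℕ → Ω → H} {γ R : ℝ}

lemma norm_sq_add_sum_inner_le_energy {D : ℕ → Ω → H} {ω : Ω}
    (hstep : ∀ n, h (n + 1) ω = h n ω - γ • (X n ω + D n ω))
    (hbound : ∀ n, ‖X n ω + D n ω‖ ≤ R) (n : ℕ) :
    ‖h n ω‖ ^ 2 + 2 * γ * ∑ k ∈ Finset.range n, inner ℝ (h k ω) (D k ω)
      ≤ energy h X γ R n ω := by
  induction n with
  | zero => simp [energy]
  | succ n ih =>
    have h₁ : ‖h (n + 1) ω‖ ^ 2 ≤ ‖h n ω‖ ^ 2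
        - 2 * γ * (inner ℝ (h n ω) (X n ω) + inner ℝ (h n ω) (D n ω)) + (γ * R) ^ 2 := by
      rw [hstep, norm_sub_sq_real, inner_smul_right, inner_add_right, norm_smul, mul_pow,
        mul_pow, Real.norm_eq_abs, sq_abs]
      have := mul_le_mul_of_nonneg_left (pow_le_pow_left₀ (norm_nonneg _) (hbound n) 2)
        (sq_nonneg γ)
      linarith
    rw [energy_succ, Finset.sum_range_succ]
    linarith

lemma isBoundedMeasurable_energy {m0 : MeasurableSpace Ω} {P : Measure Ω}
    {ℱ : Filtration ℕ m0} (hh : ∀ n, IsBoundedMeasurable (ℱ n) P (h n))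
    (hX : ∀ n, IsBoundedMeasurable (ℱ (n + 1)) P (X n)) (n : ℕ) :
    IsBoundedMeasurable (ℱ n) P (energy h X γ R n) :=
  (((hh 0).mono (ℱ.mono n.zero_le)).norm_sq.add (.const _)).sub
    ((IsBoundedMeasurable.const (2 * γ)).mul (.sum fun k hk =>
      ((hh k).mono (ℱ.mono hk.le)).inner ((hX k).mono (ℱ.mono hk))))

end Energy

section Recursion

variable {H : Type*} [NormedAddCommGroup H] [InnerProductSpace ℝ H] [CompleteSpace H]
  {Ω : Type*} {m0 : MeasurableSpace Ω} {P : Measure Ω} [IsProbabilityMeasure P]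
  {ℱ : Filtration ℕ m0}

/-- A bounded martingale difference sequence is orthogonal in `L²`. -/
lemma integral_norm_sq_sum_le {X : ℕ → Ω → H} {B : ℝ}
    (hX : ∀ n, IsBoundedMeasurable (ℱ (n + 1)) P (X n))
    (hXB : ∀ n, ∀ᵐ ω ∂P, ‖X n ω‖ ≤ B) (hX0 : ∀ n, P[X n | ℱ n] =ᵐ[P] 0) (n : ℕ) :
    ∫ ω, ‖∑ k ∈ Finset.range n, X k ω‖ ^ 2 ∂P ≤ n * B ^ 2 := by
  induction n with
  | zero => simp
  | succ n ih =>
    have hS : IsBoundedMeasurable (ℱ n) P fun ω => ∑ k ∈ Finset.range n, X k ω :=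
      .sum fun k hk => (hX k).mono (ℱ.mono hk)
    have hXi := (hX n).integrable (ℱ.le _)
    have hin := ((hS.mono (ℱ.mono n.le_succ)).inner (hX n)).integrable (ℱ.le _)
    have hSi := hS.norm_sq.integrable (ℱ.le _)
    have hXi2 := (hX n).norm_sq.integrable (ℱ.le _)
    have h0 := integral_inner_eq_zero_of_condExp (ℱ.le n) hS hXi (hX0 n)
    have hB : ∫ ω, ‖X n ω‖ ^ 2 ∂P ≤ B ^ 2 := by
      have := integral_mono_ae hXi2 (integrable_const (B ^ 2)) <| by
        filter_upwards [hXB n] with ω hω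
        exact pow_le_pow_left₀ (norm_nonneg _) hω 2
      simpa using this
    simp only [Finset.sum_range_succ, norm_add_sq_real]
    rw [integral_add (hSi.fun_add (hin.const_mul 2)) hXi2, integral_add hSi (hin.const_mul 2),
      integral_const_mul, h0]
    push_cast
    linarith

variable {h X : ℕ → Ω → H} {γ R d : ℝ}

lemma integral_energy (hh0 : ∀ ω, ‖h 0 ω‖ = d) (hh : ∀ n, IsBoundedMeasurable (ℱ n) P (h n))
    (hX : ∀ n, IsBoundedMeasurable (ℱ (n + 1)) P (X n)) (hX0 : ∀ n, P[X n | ℱ n] =ᵐ[P] 0)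
    (n : ℕ) : ∫ ω, energy h X γ R n ω ∂P = d ^ 2 + n * (γ * R) ^ 2 := by
  induction n with
  | zero => simp [energy, hh0]
  | succ n ih =>
    have hXi := (hX n).integrable (ℱ.le _)
    have hin := (((hh n).mono (ℱ.mono n.le_succ)).inner (hX n)).integrable (ℱ.le _)
    have hEi := (isBoundedMeasurable_energy (γ := γ) (R := R) hh hX n).integrable (ℱ.le _)
    have h0 := integral_inner_eq_zero_of_condExp (ℱ.le n) (hh n) hXi (hX0 n)
    simp only [energy_succ]
    rw [integral_sub (hEi.fun_add (integrable_const _)) (hin.const_mul _),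
      integral_add hEi (integrable_const _), integral_const_mul, h0, ih]
    simp
    ring

/-- The conditional variance of the increment of the energy is at most `16 (γ R)²` times the energy
itself, so its second moment stays comparable to the square of its mean. -/
lemma integral_energy_sq_le (hh0 : ∀ ω, ‖h 0 ω‖ = d)
    (hh : ∀ n, IsBoundedMeasurable (ℱ n) P (h n))
    (hX : ∀ n, IsBoundedMeasurable (ℱ (n + 1)) P (X n)) (hX0 : ∀ n, P[X n | ℱ n] =ᵐ[P] 0)
    (hXB : ∀ n, ∀ᵐ ω ∂P, ‖X n ω‖ ≤ 2 * R)
    (hle : ∀ n, ∀ᵐ ω ∂P, ‖h n ω‖ ^ 2 ≤ energy h X γ R n ω) (n : ℕ) :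
    ∫ ω, energy h X γ R n ω ^ 2 ∂P ≤ (d ^ 2 + 9 * n * (γ * R) ^ 2) ^ 2 := by
  induction n with
  | zero => simp [energy, hh0]
  | succ n ih =>
    set x := (γ * R) ^ 2 with hx
    have hx0 : 0 ≤ x := sq_nonneg _
    have hXi := (hX n).integrable (ℱ.le _)
    have hE := isBoundedMeasurable_energy (γ := γ) (R := R) hh hX n
    have hY : IsBoundedMeasurable (ℱ n) P
        fun ω => (4 * γ * (energy h X γ R n ω + x)) • h n ω :=
      ((IsBoundedMeasurable.const (4 * γ)).mul (hE.add (.const x))).smul (hh n)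
    have hin := ((hY.mono (ℱ.mono n.le_succ)).inner (hX n)).integrable (ℱ.le _)
    have hEi := hE.integrable (ℱ.le _)
    have hEi2 := hE.sq.integrable (ℱ.le _)
    have h0 := integral_inner_eq_zero_of_condExp (ℱ.le n) hY hXi (hX0 n)
    -- `18 = 2 + 16`: the cross term with the drift `x`, and the conditional variance
    have hmono : ∫ ω, energy h X γ R (n + 1) ω ^ 2 ∂P
        ≤ ∫ ω, (energy h X γ R n ω ^ 2 + 18 * x * energy h X γ R n ω + x ^ 2
          - inner ℝ ((4 * γ * (energy h X γ R n ω + x)) • h n ω) (X n ω)) ∂P := integral_mono_ae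
      ((isBoundedMeasurable_energy (γ := γ) (R := R) hh hX (n + 1)).sq.integrable (ℱ.le _))
      (((hEi2.fun_add (hEi.const_mul (18 * x))).fun_add (integrable_const (x ^ 2))).sub
        hin) <| by
        filter_upwards [hXB n, hle n] with ω h₁ h₂
        have h₃ : inner ℝ (h n ω) (X n ω) ^ 2 ≤ energy h X γ R n ω * (2 * R) ^ 2 := by
          have := pow_le_pow_left₀ (abs_nonneg _) (abs_real_inner_le_norm (h n ω) (X n ω)) 2
          rw [sq_abs, mul_pow] at this
          exact this.trans (mul_le_mul h₂ (pow_le_pow_left₀ (norm_nonneg _) h₁ 2) (sq_nonneg _)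
            ((sq_nonneg _).trans h₂))
        simp only [energy_succ, real_inner_smul_left]
        have h₄ := mul_le_mul_of_nonneg_left h₃ (sq_nonneg (2 * γ))
        rw [← hx]
        have h₅ : (2 * γ) ^ 2 * (energy h X γ R n ω * (2 * R) ^ 2)
            = 16 * x * energy h X γ R n ω := by
          rw [hx]
          ring
        rw [h₅] at h₄
        linarith
    rw [integral_sub ((hEi2.fun_add (hEi.const_mul (18 * x))).fun_add
        (integrable_const (x ^ 2))) hin,
      integral_add (hEi2.fun_add (hEi.const_mul (18 * x))) (integrable_const (x ^ 2)),
      integral_add hEi2 (hEi.const_mul (18 * x)), integral_const_mul,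
      integral_energy hh0 hh hX hX0, h0] at hmono
    simp only [integral_const, probReal_univ, one_smul, ← hx] at hmono
    push_cast
    have h₆ : 0 ≤ (n : ℝ) * x ^ 2 := by positivity
    nlinarith [sq_nonneg x]

end Recursion

/-! ### The averaged iterate -/

section Average

variable {H : Type*} [NormedAddCommGroup H] [InnerProductSpace ℝ H] [CompleteSpace H]

/-- The deterministic part of the argument, along one trajectory with noise `X`: the averaged
gradient telescopes to the noise average plus `(h 0 - h N) / (N c)`. -/
lemma GeneralizedSelfConcordant.average_bounds_of_trajectory {f : H → ℝ} {R : ℝ}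
    (hsc : GeneralizedSelfConcordant R f)
    (hf : ThreeTimesDifferentiable f) (hR : 0 < R) (hconv : ConvexOn ℝ Set.univ f) {x : H}
    (hx : fderiv ℝ f x = 0) {μ : ℝ} (hμ : 0 < μ)
    (hq : ∀ v, μ * ‖v‖ ^ 2 ≤ secondDeriv f x v v) {N : ℕ} (hN : 0 < N) {h X : ℕ → H} {c A : ℝ}
    (hc : 0 < c) (hstep : ∀ n, h (n + 1) = h n - c • (X n + gradient f (x + h n)))
    (hA : ‖h N‖ ^ 2
      + 2 * c * ∑ k ∈ Finset.range N, inner ℝ (h k) (gradient f (x + h k)) ≤ A)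
    {hbar : H} (hbar_eq : (N : ℝ) • hbar = ∑ k ∈ Finset.range N, h k) {U : ℝ}
    (hU : U = (4 * ‖∑ k ∈ Finset.range N, X k‖ ^ 2 + 8 / c ^ 2 * (‖h 0‖ ^ 2 + A)
      + 169 * R ^ 2 / (2 * c ^ 2) * A ^ 2) / N ^ 2) :
    ‖hbar‖ ^ 2 ≤ U / μ ^ 2 ∧ f (x + hbar) - f x ≤ 3 / 2 * (U / μ) := by
  have hN' : (0 : ℝ) < N := Nat.cast_pos.2 hN
  set S := ∑ k ∈ Finset.range N, X k with hS
  set T := ∑ k ∈ Finset.range N, fderiv ℝ f (x + h k) (h k) with hT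
  have hT' : ∑ k ∈ Finset.range N, inner ℝ (h k) (gradient f (x + h k)) = T :=
    Finset.sum_congr rfl fun k _ => by rw [real_inner_comm, inner_gradient]
  rw [hT'] at hA
  have hT0 : 0 ≤ T := Finset.sum_nonneg fun k _ => by
    have h₁ := hf.sub_le_fderiv hconv x (h k)
    have h₂ := hf.add_fderiv_le hconv x (h k)
    rw [hx, zero_apply] at h₂
    linarith
  have htel : c • ∑ k ∈ Finset.range N, gradient f (x + h k) = h 0 - h N - c • S := by
    rw [← Finset.sum_range_sub', hS, Finset.smul_sum, Finset.smul_sum, ← Finset.sum_sub_distrib]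
    refine Finset.sum_congr rfl fun k _ => ?_
    rw [hstep k, smul_add]
    abel
  have hnorm : ‖∑ k ∈ Finset.range N, fderiv ℝ f (x + h k)‖
      = ‖∑ k ∈ Finset.range N, gradient f (x + h k)‖ := by
    simp only [gradient, ← map_sum, LinearIsometryEquiv.norm_map]
  have hgrad : ‖∑ k ∈ Finset.range N, fderiv ℝ f (x + h k)‖ ≤ ‖S‖ + (‖h 0‖ + ‖h N‖) / c := by
    have h₁ : c * ‖∑ k ∈ Finset.range N, gradient f (x + h k)‖ ≤ ‖h 0‖ + ‖h N‖ + c * ‖S‖ := by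
      have h₂ := norm_sub_le (h 0 - h N) (c • S)
      rw [← htel, norm_smul, norm_smul, Real.norm_of_nonneg hc.le] at h₂
      linarith [norm_sub_le (h 0) (h N)]
    rw [hnorm, ← sub_le_iff_le_add', le_div_iff₀ hc]
    linarith
  have hTA : T ≤ A / (2 * c) := by
    rw [le_div_iff₀ (by positivity)]
    nlinarith [sq_nonneg ‖h N‖]
  have hA' : ‖h N‖ ^ 2 ≤ A := by nlinarith [mul_nonneg hc.le hT0]
  set G := (‖S‖ + (‖h 0‖ + ‖h N‖) / c + 13 * R * (A / (2 * c))) / N with hG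
  obtain ⟨h₁, h₂⟩ := hsc.average_bounds hf hR hconv hx hμ hq hN h hbar_eq (G := G) (by
    rw [hG, mul_div_cancel₀ _ hN'.ne']
    gcongr)
  have hGU : G ^ 2 ≤ U := by
    rw [hG, hU, div_pow]
    gcongr
    have e₁ : 8 / c ^ 2 * (‖h 0‖ ^ 2 + A) = 4 * (2 * ‖h 0‖ ^ 2 + 2 * A) / c ^ 2 := by ring
    have e₂ : 169 * R ^ 2 / (2 * c ^ 2) * A ^ 2 = 2 * (13 * R * (A / (2 * c))) ^ 2 := by
      field_simp
      ring
    have h₃ : 4 * ((‖h 0‖ + ‖h N‖) / c) ^ 2 ≤ 4 * (2 * ‖h 0‖ ^ 2 + 2 * A) / c ^ 2 := by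
      rw [div_pow, ← mul_div_assoc]
      gcongr
      nlinarith [sq_nonneg (‖h 0‖ - ‖h N‖)]
    rw [e₁, e₂]
    nlinarith [sq_nonneg (‖S‖ + (‖h 0‖ + ‖h N‖) / c - 13 * R * (A / (2 * c))),
      sq_nonneg (‖S‖ - (‖h 0‖ + ‖h N‖) / c)]
  exact ⟨h₁.trans (by gcongr), h₂.trans (by gcongr)⟩

end Average

theorem mainTheorem1
    {H : Type*} [NormedAddCommGroup H] [InnerProductSpace ℝ H] [CompleteSpace H]
    {Ω : Type*} {m0 : MeasurableSpace Ω} (P : Measure Ω) [IsProbabilityMeasure P]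
    (ℱ : Filtration ℕ m0)
    (f : H → ℝ) (F : ℕ → Ω → H → ℝ) (θ₀ θstar : H)
    (R : ℝ) (hR : 0 < R) (N : ℕ) (hN : 1 ≤ N)
    -- the constant step size
    (γ : ℕ → ℝ) (hγ : ∀ n, γ n = 1 / (2 * R ^ 2 * √(N : ℝ)))
    -- (A1) convexity and differentiability of `f`
    (hconv : ConvexOn ℝ Set.univ f) (hdiff : ThreeTimesDifferentiable f)
    -- (A2) generalized self-concordance of `f`
    (hsc : GeneralizedSelfConcordant R f)
    -- (A3) attained global minimum
    (hmin : ∀ θ, f θstar ≤ f θ)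
    -- (A4) bounded gradients
    (hgrad : ∀ θ, ‖gradient f θ‖ ≤ R)
    (hFdiff : ∀ n ≥ 1, ∀ ω, Differentiable ℝ (F n ω))
    (hFgrad : ∀ n ≥ 1, ∀ᵐ ω ∂P, ∀ θ, ‖gradient (F n ω) θ‖ ≤ R)
    -- (A5) adapted measurability
    (hFmeas : ∀ n ≥ 1, ∀ θ, Measurable[ℱ n] fun ω => F n ω θ)
    -- (A6) unbiased gradients along the recursion (A7)
    (hFint : ∀ n ≥ 1,
      Integrable (fun ω => gradient (F n ω) (sgdIterate F γ θ₀ (n - 1) ω)) P)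
    (hunb : ∀ n ≥ 1,
      P[fun ω => gradient (F n ω) (sgdIterate F γ θ₀ (n - 1) ω) | ℱ (n - 1)]
        =ᵐ[P] fun ω => gradient f (sgdIterate F γ θ₀ (n - 1) ω))
    -- lowest eigenvalue of the Hessian at the optimum
    (μ : ℝ) (hμ : 0 < μ) (hμeig : IsLowestEigenvalue (hessian f θstar) μ) :
    (Integrable (fun ω => f (sgdAverage F γ θ₀ N ω)) P ∧
      (∫ ω, f (sgdAverage F γ θ₀ N ω) ∂P) - f θstar
        ≤ R ^ 2 / (N * μ) * (5 * R * ‖θ₀ - θstar‖ + 15) ^ 4) ∧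
    (Integrable (fun ω => ‖sgdAverage F γ θ₀ N ω - θstar‖ ^ 2) P ∧
      (∫ ω, ‖sgdAverage F γ θ₀ N ω - θstar‖ ^ 2 ∂P)
        ≤ R ^ 2 / (N * μ ^ 2) * (6 * R * ‖θ₀ - θstar‖ + 21) ^ 4) := by
  have hN' : (0 : ℝ) < N := Nat.cast_pos.2 hN
  obtain ⟨c, hc⟩ : ∃ c, c = 1 / (2 * R ^ 2 * √(N : ℝ)) := ⟨_, rfl⟩
  have hc0 : 0 < c := by rw [hc]; positivity
  have hcsq : c ^ 2 = 1 / (4 * R ^ 4 * N) := by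
    rw [hc, div_pow, mul_pow, Real.sq_sqrt hN'.le]
    ring
  have hγc : ∀ n, γ n = c := fun n => (hγ n).trans hc.symm
  have hx : fderiv ℝ f θstar = 0 := IsLocalMin.fderiv_eq_zero (.of_forall hmin)
  have hq := hdiff.mul_sq_norm_le_secondDeriv hμeig
  set θ := sgdIterate F γ θ₀ with hθ
  -- the stochastic gradients, and the noise in them
  set g : ℕ → Ω → H := fun n ω => gradient (F (n + 1) ω) (θ n ω) with hg
  set X : ℕ → Ω → H := fun n ω => g n ω - gradient f (θ n ω) with hX
  set h : ℕ → Ω → H := fun n ω => θ n ω - θstar with hh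
  have hθm : ∀ n, AEStronglyMeasurable[ℱ n] (θ n) P :=
    aestronglyMeasurable_sgdIterate hFdiff hFmeas hFint
  have hgb : ∀ n, IsBoundedMeasurable (ℱ (n + 1)) P (g n) := fun n =>
    ⟨aestronglyMeasurable_gradient (ℱ.le _) (hFdiff _ n.succ_pos) (hFmeas _ n.succ_pos)
      ((hθm n).mono (ℱ.mono n.le_succ)) (hFint (n + 1) n.succ_pos), R,
      (hFgrad (n + 1) n.succ_pos).mono fun ω hω => hω _⟩
  have hθb : ∀ n, IsBoundedMeasurable (ℱ n) P (θ n) := fun n => by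
    induction n with
    | zero => exact .const θ₀
    | succ n ih =>
      exact (ih.mono (ℱ.mono n.le_succ)).sub ((IsBoundedMeasurable.const (γ (n + 1))).smul (hgb n))
  have hDb : ∀ n, IsBoundedMeasurable (ℱ n) P fun ω => gradient f (θ n ω) := fun n =>
    ⟨hdiff.continuous_gradient.comp_aestronglyMeasurable (hθm n), R, .of_forall fun _ => hgrad _⟩
  have hXb : ∀ n, IsBoundedMeasurable (ℱ (n + 1)) P (X n) := fun n =>
    (hgb n).sub ((hDb n).mono (ℱ.mono n.le_succ))
  have hhb : ∀ n, IsBoundedMeasurable (ℱ n) P (h n) := fun n => (hθb n).sub (.const θstar)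
  have hXB : ∀ n, ∀ᵐ ω ∂P, ‖X n ω‖ ≤ 2 * R := fun n => by
    filter_upwards [hFgrad (n + 1) n.succ_pos] with ω hω
    have h₁ := norm_sub_le (g n ω) (gradient f (θ n ω))
    linarith [hω (θ n ω), hgrad (θ n ω)]
  have hX0 : ∀ n, P[X n | ℱ n] =ᵐ[P] 0 := fun n => by
    have h₁ := condExp_sub ((hgb n).integrable (ℱ.le _)) ((hDb n).integrable (ℱ.le _)) (ℱ n)
    have h₂ := condExp_of_aestronglyMeasurable' (ℱ.le n) (hDb n).1
      ((hDb n).integrable (ℱ.le _))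
    filter_upwards [h₁, h₂, hunb (n + 1) n.succ_pos] with ω h₁ h₂ h₃
    refine h₁.trans ?_
    rw [Pi.sub_apply, h₂, Pi.zero_apply, sub_eq_zero]
    exact h₃
  have hh0 : ∀ ω, ‖h 0 ω‖ = ‖θ₀ - θstar‖ := fun ω => rfl
  have hstep : ∀ n ω, h (n + 1) ω
      = h n ω - c • (X n ω + gradient f (θstar + h n ω)) := fun n ω => by
    simp only [hh, hX, add_sub_cancel, sub_add_cancel, ← hγc (n + 1)]
    exact sub_right_comm _ _ _
  have hpath : ∀ᵐ ω ∂P, ∀ n, ‖h n ω‖ ^ 2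
      + 2 * c * ∑ k ∈ Finset.range n, inner ℝ (h k ω) (gradient f (θstar + h k ω))
        ≤ energy h X c R n ω := by
    have : ∀ᵐ ω ∂P, ∀ n, ‖g n ω‖ ≤ R := ae_all_iff.2 fun n =>
      (hFgrad (n + 1) n.succ_pos).mono fun ω hω => hω _
    filter_upwards [this] with ω hω
    refine norm_sq_add_sum_inner_le_energy (D := fun n ω => gradient f (θstar + h n ω))
      (fun n => hstep n ω) fun n => ?_
    simpa only [hh, hX, add_sub_cancel, sub_add_cancel] using hω n
  have hle : ∀ n, ∀ᵐ ω ∂P, ‖h n ω‖ ^ 2 ≤ energy h X c R n ω := fun n => by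
    filter_upwards [hpath] with ω hω
    refine le_trans (le_add_of_nonneg_right ?_) (hω n)
    refine mul_nonneg (by positivity) (Finset.sum_nonneg fun k _ => ?_)
    rw [real_inner_comm, inner_gradient]
    have h₁ := hdiff.sub_le_fderiv hconv θstar (h k ω)
    linarith [hmin (θstar + h k ω)]
  set A := energy h X c R N with hA
  have hAb : IsBoundedMeasurable (ℱ N) P A := isBoundedMeasurable_energy hhb hXb N
  have hSb : IsBoundedMeasurable (ℱ N) P fun ω => ∑ k ∈ Finset.range N, X k ω :=
    .sum fun k hk => (hXb k).mono (ℱ.mono hk)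
  have hAi := hAb.integrable (ℱ.le _)
  have hA2i := hAb.sq.integrable (ℱ.le _)
  have hSi := hSb.norm_sq.integrable (ℱ.le _)
  set d := ‖θ₀ - θstar‖ with hd
  set U : Ω → ℝ := fun ω => (4 * ‖∑ k ∈ Finset.range N, X k ω‖ ^ 2
    + 8 / c ^ 2 * (d ^ 2 + A ω) + 169 * R ^ 2 / (2 * c ^ 2) * A ω ^ 2) / N ^ 2 with hU
  have hUi : Integrable U P := (((hSi.const_mul 4).add
    (((integrable_const (d ^ 2)).add hAi).const_mul _)).add (hA2i.const_mul _)).div_const _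
  -- second moments of the noise and of the energy; `N (c R)² = 1 / (4 R²)`
  have hUint : ∫ ω, U ω ∂P
      ≤ R ^ 2 / N * (24 + 64 * (R * d) ^ 2 + 338 * ((R * d) ^ 2 + 9 / 4) ^ 2) := by
    have h₁ := integral_norm_sq_sum_le hXb hXB hX0 N
    have h₂ := integral_energy (γ := c) (R := R) hh0 hhb hXb hX0 N
    have h₃ := integral_energy_sq_le hh0 hhb hXb hX0 hXB hle N
    have hNx : N * (c * R) ^ 2 = 1 / (4 * R ^ 2) := by
      rw [mul_pow, hcsq]
      field_simp
    rw [mul_assoc, hNx] at h₃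
    rw [hNx] at h₂
    rw [← hA] at h₂ h₃
    have h₄ : ∫ ω, U ω ∂P = (4 * ∫ ω, ‖∑ k ∈ Finset.range N, X k ω‖ ^ 2 ∂P
        + 8 / c ^ 2 * (d ^ 2 + ∫ ω, A ω ∂P)
        + 169 * R ^ 2 / (2 * c ^ 2) * ∫ ω, A ω ^ 2 ∂P) / N ^ 2 := by
      simp only [hU]
      rw [integral_div, integral_add ((hSi.const_mul 4).fun_add
        (((integrable_const (d ^ 2)).fun_add hAi).const_mul _)) (hA2i.const_mul _),
        integral_add (hSi.const_mul 4) (((integrable_const (d ^ 2)).fun_add hAi).const_mul _),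
        integral_const_mul, integral_const_mul, integral_const_mul,
        integral_add (integrable_const (d ^ 2)) hAi]
      simp
    rw [h₄, h₂]
    calc _ ≤ (4 * (N * (2 * R) ^ 2) + 8 / c ^ 2 * (d ^ 2 + (d ^ 2 + 1 / (4 * R ^ 2)))
        + 169 * R ^ 2 / (2 * c ^ 2) * (d ^ 2 + 9 * (1 / (4 * R ^ 2))) ^ 2) / N ^ 2 := by gcongr
      _ = _ := by
        rw [hcsq]
        field_simp
        ring
  have hbar_eq : ∀ ω, (N : ℝ) • (sgdAverage F γ θ₀ N ω - θstar)
      = ∑ k ∈ Finset.range N, h k ω := fun ω => by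
    simp only [hh, sgdAverage, smul_sub, smul_smul, mul_one_div_cancel hN'.ne', one_smul,
      Finset.sum_sub_distrib, Finset.sum_const, Finset.card_range, Nat.cast_smul_eq_nsmul, hθ]
  have hbounds : ∀ᵐ ω ∂P, ‖sgdAverage F γ θ₀ N ω - θstar‖ ^ 2 ≤ U ω / μ ^ 2 ∧
      f (sgdAverage F γ θ₀ N ω) - f θstar ≤ 3 / 2 * (U ω / μ) := by
    filter_upwards [hpath] with ω hω
    have := hsc.average_bounds_of_trajectory hdiff hR hconv hx hμ hq hN hc0
      (fun n => hstep n ω) (hω N) (hbar_eq ω) (U := U ω) rfl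
    rwa [add_sub_cancel] at this
  have hbarb : IsBoundedMeasurable (ℱ N) P (sgdAverage F γ θ₀ N) :=
    (IsBoundedMeasurable.const (1 / (N : ℝ))).smul
      (.sum fun k hk => (hθb k).mono (ℱ.mono hk.le))
  have hgapi : Integrable (fun ω => f (sgdAverage F γ θ₀ N ω) - f θstar) P := by
    refine ((hUi.div_const μ).const_mul (3 / 2)).mono'
      ((hdiff.1.continuous.comp_aestronglyMeasurable (hbarb.1.mono (ℱ.le N))).sub
        aestronglyMeasurable_const) ?_
    filter_upwards [hbounds] with ω hω
    rw [Real.norm_of_nonneg (sub_nonneg.2 (hmin _))]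
    exact hω.2
  have hfi : Integrable (fun ω => f (sgdAverage F γ θ₀ N ω)) P := by
    exact (hgapi.add (integrable_const (f θstar))).congr (.of_forall fun ω => by simp)
  have hnormi : Integrable (fun ω => ‖sgdAverage F γ θ₀ N ω - θstar‖ ^ 2) P :=
    (hbarb.sub (.const θstar)).norm_sq.integrable (ℱ.le _)
  have hr : 0 ≤ R * d := by positivity
  refine ⟨⟨hfi, ?_⟩, hnormi, ?_⟩
  · have h₁ := integral_mono_ae hgapi ((hUi.div_const μ).const_mul (3 / 2))
      (hbounds.mono fun ω hω => hω.2)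
    rw [integral_sub hfi (integrable_const _), integral_const_mul, integral_div] at h₁
    simp only [integral_const, probReal_univ, one_smul] at h₁
    refine h₁.trans ?_
    calc 3 / 2 * ((∫ ω, U ω ∂P) / μ)
        ≤ 3 / 2 * ((R ^ 2 / N
          * (24 + 64 * (R * d) ^ 2 + 338 * ((R * d) ^ 2 + 9 / 4) ^ 2)) / μ) := by gcongr
      _ = R ^ 2 / (N * μ) * (3 / 2 * (24 + 64 * (R * d) ^ 2
          + 338 * ((R * d) ^ 2 + 9 / 4) ^ 2)) := by
        field_simp
      _ ≤ _ := by
        gcongr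
        rw [mul_assoc 5]
        nlinarith [pow_nonneg hr 2, pow_nonneg hr 3, pow_nonneg hr 4]
  · have h₁ := integral_mono_ae hnormi (hUi.div_const (μ ^ 2))
      (hbounds.mono fun ω hω => hω.1)
    rw [integral_div] at h₁
    refine h₁.trans ?_
    calc (∫ ω, U ω ∂P) / μ ^ 2
        ≤ (R ^ 2 / N
          * (24 + 64 * (R * d) ^ 2 + 338 * ((R * d) ^ 2 + 9 / 4) ^ 2)) / μ ^ 2 := by gcongr
      _ = R ^ 2 / (N * μ ^ 2) * (24 + 64 * (R * d) ^ 2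
          + 338 * ((R * d) ^ 2 + 9 / 4) ^ 2) := by
        field_simp
      _ ≤ _ := by
        gcongr
        rw [mul_assoc 6]
        nlinarith [pow_nonneg hr 2, pow_nonneg hr 3, pow_nonneg hr 4]
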